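/- Let $\Delta \ge 2$ be a constant. Sinkless orientation has deterministic round complexity $\Omega(\log n)$ on trees of maximum degree at most $\Delta$. Precisely: A deterministic local algorithm $\mathcal A$ with round complexity $t(n)$ is a function of the number $n$ of nodes and of a ball of radius $t(n)$ whose nodes are labeled with identifiers. It is run on an $n$-node graph $G$, whose nodes carry pairwise distinct identifiers from $\{1,\dots,n^{C}\}$, by applying it, for every node $u$, to $n$ and to the labeled ball $B_G(u,t(n))$ (the subgraph induced by the nodes at distance at most $t(n)$ from $u$, with $u$ marked as its center); the output at $u$ says which of the edges at $u$ are outgoing, by giving a set of identifiers that contains the identifier of a neighbor $v$ exactly if $uv$ is to be directed from $u$ to $v$. The algorithm solves sinkless orientation on a tree $G$ of maximum degree at most $\Delta$ if, for every such labeling, the two endpoints of every edge agree on its direction, and no node of degree exactly $\Delta$ has all its $\Delta$ incident edges directed towards it (nodes of smaller degree are not constrained). Then there are $c>0$ and $n_0$, depending only on $\Delta$, such that for every integer $C\ge 1$, every $n\ge n_0$ and every deterministic local algorithm with round complexity $t(\cdot)$ that solves sinkless orientation on all $n$-node trees of maximum degree at most $\Delta$ with identifiers from $\{1,\dots,n^{C}\}$,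 we have $t(n)\ge c\log n$. -/

import Mathlib

/-- A graph with one highlighted node whose nodes are labeled with pairwise distinct identifiers,
in canonical form: each node is represented by its identifier. Two uniquely labeled neighborhoods
are isomorphic (respecting centers and labels) if and only if they have the same canonical form,
so a function of this structure is the same as a function of the labeled neighborhood. -/
@[ext]
structure LabeledNeighborhood where
  /-- the identifier of the highlighted node -/
  center : ℕ
  /-- the identifiers of all nodes -/
  nodes : Set ℕ
  /-- adjacency between nodes, given by their identifiers -/
  Adj : ℕ → ℕ → Prop

/-- The node set of the ball of radius `r` around `u`: all nodes at distance at most `r`. -/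
def ballNodes {V : Type} (G : SimpleGraph V) (u : V) (r : ℕ) : Set V :=
  {v | G.edist u v ≤ (r : ℕ∞)}

/-- The ball of radius `r` around `u`, as the subgraph induced by the nodes at distance at most `r`,
centered at `u` and labeled with the identifiers `ident`. -/
def labeledBall {V : Type} (G : SimpleGraph V) (ident : V → ℕ) (u : V) (r : ℕ) :
    LabeledNeighborhood where
  center := ident u
  nodes := ident '' ballNodes G u r
  Adj a b := ∃ v ∈ ballNodes G u r, ∃ w ∈ ballNodes G u r, G.Adj v w ∧ ident v = a ∧ ident w = b

/-- A deterministic local algorithm: it takes the number `n` of nodes of the input graph and a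
labeled neighborhood, and returns an output for the center. There is no bound on its
computational power. -/
abbrev LocalAlgorithm (Out : Type) : Type := ℕ → LabeledNeighborhood → Out

/-- Running `A` with round complexity `t` on `G`: each node `u` outputs the value of `A` on `n` and
the labeled ball of radius `t n` around `u`, where `n` is the number of nodes of `G`. -/
noncomputable def LocalAlgorithm.run {Out : Type} (A : LocalAlgorithm Out) (t : ℕ → ℕ)
    {V : Type} (G : SimpleGraph V) (ident : V → ℕ) (u : V) : Out :=
  A (Nat.card V) (labeledBall G ident u (t (Nat.card V)))

/-- Unique identifiers from the range `{1, …, N}`. -/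
def IsIdentifierAssignment {V : Type} (N : ℕ) (ident : V → ℕ) : Prop :=
  Function.Injective ident ∧ ∀ v, 1 ≤ ident v ∧ ident v ≤ N

/-- The relation `o u v` (read: the edge `uv` is oriented from `u` to `v`) is an orientation of all
edges of `G`: it holds only along edges, and each edge gets exactly one of its two directions. -/
def IsOrientation {V : Type} (G : SimpleGraph V) (o : V → V → Prop) : Prop :=
  (∀ u v, o u v → G.Adj u v) ∧ ∀ u v, G.Adj u v → Xor (o u v) (o v u)

/-- A sink is a node of degree `Δ` all of whose edges are oriented towards it. -/
def IsSink {V : Type} (Δ : ℕ) (G : SimpleGraph V) (o : V → V → Prop) (v : V) : Prop :=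
  (G.neighborSet v).ncard = Δ ∧ ∀ w, G.Adj v w → o w v

/-- A sinkless orientation, with respect to the degree parameter `Δ`. -/
def IsSinklessOrientation {V : Type} (Δ : ℕ) (G : SimpleGraph V) (o : V → V → Prop) : Prop :=
  IsOrientation G o ∧ ∀ v, ¬ IsSink Δ G o v

/-- The edge directions described by node outputs: each node `u` outputs a set of identifiers, and
it claims the edge to its neighbor `v` to be outgoing iff the identifier of `v` is in the set. -/
def outputDirections {V : Type} (G : SimpleGraph V) (ident : V → ℕ) (out : V → Set ℕ)
    (u v : V) : Prop :=
  G.Adj u v ∧ ident v ∈ out u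

/-- The algorithm `A`, run with round complexity `t`, solves sinkless orientation on all trees with
`n` nodes and maximum degree at most `Δ`, for all unique identifiers from `{1, …, n ^ C}`.
The two endpoints of each edge have to agree on its direction. -/
def SolvesSinklessOrientation (A : LocalAlgorithm (Set ℕ)) (t : ℕ → ℕ) (Δ C n : ℕ) : Prop :=
  ∀ (V : Type) [Finite V] (G : SimpleGraph V) (ident : V → ℕ),
    Nat.card V = n → G.IsTree → (∀ v, (G.neighborSet v).ncard ≤ Δ) →
    IsIdentifierAssignment (n ^ C) ident →
    IsSinklessOrientation Δ G (outputDirections G ident (A.run t G ident))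

/-! The proof is round elimination on one fixed graph. Take a graph on at most `n` vertices, regular
of degree `2 * Δ - 1`, properly edge-colored and without short cycles, and fix its identifiers once
and for all; only the set of selected edges varies. Where the selection is `Δ`-regular, it agrees
locally with an `n`-node tree of maximum degree at most `Δ` (`exists_isTree_adj_iff`), so an
algorithm with `t n` rounds gives a rule of radius `t n + 1`
(`SolvesSinklessOrientation.exists_isSinklessRule`).

A rule of radius `k + 1` yields one of radius `k` (`IsSinklessRule.eliminate`): the parts behind
different neighbors share no edge outside the common view, so bad extensions of that view can be
glued. Radius 0 is impossible (`not_isSinklessRule_zero`): every vertex can be made to output at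
least `Δ` of the `2 * Δ - 1` colors, so by averaging some vertex can be pointed at along `Δ` edges,
and selecting these makes it a sink.

Hence `t n` is at least about the tree-like radius, which is logarithmic in `n` for a Cayley graph
of reflections modulo `m` (`exists_locallyInjective`). As the identifiers never vary, the constants
do not depend on `C`. -/

/-! ### Forests and their extension to trees of bounded degree -/

/-- Every connected component of a finite acyclic graph has a vertex with at most one neighbor. -/
theorem exists_reachable_ncard_le_one {V : Type} [Finite V] {G : SimpleGraph V}
    (hG : G.IsAcyclic) (u : V) : ∃ v, G.Reachable u v ∧ (G.neighborSet v).ncard ≤ 1 := by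
  classical
  have := Fintype.ofFinite V
  let P : ℕ → Prop := fun k => ∃ v, ∃ p : G.Walk u v, p.IsPath ∧ p.length = k
  have hP : P (Nat.findGreatest P (Fintype.card V)) :=
    Nat.findGreatest_spec (m := 0) (Nat.zero_le _) ⟨u, .nil, by simp, rfl⟩
  obtain ⟨v, p, hp, hlen⟩ := hP
  refine ⟨v, p.reachable, ?_⟩
  have hsub : G.neighborSet v ⊆ {p.penultimate} := by
    intro w hw
    by_contra hne
    have hadj : G.Adj v w := hw
    have hns : w ∉ p.support := fun h => hne (hG.eq_penultimate_of_adj_end hp hadj h)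
    have hq : (p.concat hadj).IsPath := hp.concat hns hadj
    have hlt := hq.length_lt
    have := Nat.le_findGreatest (P := P) hlt.le ⟨w, _, hq, rfl⟩
    rw [SimpleGraph.Walk.length_concat] at this
    omega
  exact (Set.ncard_le_ncard hsub).trans (Set.ncard_singleton _).le

/-- A finite forest of maximum degree at most `Δ ≥ 2` extends to a tree of maximum degree at most
`Δ`. -/
theorem exists_isTree_ge_of_isAcyclic {V : Type} [Finite V] [Nonempty V] {Δ : ℕ} (hΔ : 2 ≤ Δ)
    {F : SimpleGraph V} (hF : F.IsAcyclic) (hdeg : ∀ v, (F.neighborSet v).ncard ≤ Δ) :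
    ∃ T : SimpleGraph V, F ≤ T ∧ T.IsTree ∧ ∀ v, (T.neighborSet v).ncard ≤ Δ := by
  classical
  obtain ⟨T, hT⟩ := (Set.toFinite {T : SimpleGraph V | F ≤ T ∧ T.IsAcyclic ∧
    ∀ v, (T.neighborSet v).ncard ≤ Δ}).exists_maximal ⟨F, le_rfl, hF, hdeg⟩
  obtain ⟨⟨hFT, hac, hTd⟩, hmax⟩ := hT
  refine ⟨T, hFT, ⟨⟨?_⟩, hac⟩, hTd⟩
  by_contra hcon
  simp only [SimpleGraph.Preconnected, not_forall] at hcon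
  obtain ⟨a, b, hab⟩ := hcon
  obtain ⟨x, hax, hx⟩ := exists_reachable_ncard_le_one hac a
  obtain ⟨y, hby, hy⟩ := exists_reachable_ncard_le_one hac b
  -- Joining two vertices of degree at most 1 in different components creates no cycle and, as `2 ≤
  -- Δ`, respects the degree bound; this contradicts maximality.
  have hxy : ¬ T.Reachable x y := fun h => hab ((hax.trans h).trans hby.symm)
  have hne : x ≠ y := fun h => hxy (h ▸ .rfl)
  have hle : T ⊔ SimpleGraph.edge x y ≤ T := by
    refine hmax ⟨hFT.trans le_sup_left, hac.sup_edge_of_not_reachable hxy, fun v => ?_⟩ le_sup_left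
    have key : ∀ w, ((T ⊔ SimpleGraph.edge x y).neighborSet v) ⊆
        insert w (T.neighborSet v) → (T.neighborSet v).ncard ≤ 1 →
        ((T ⊔ SimpleGraph.edge x y).neighborSet v).ncard ≤ Δ := fun w hw h1 =>
      (Set.ncard_le_ncard hw).trans ((Set.ncard_insert_le _ _).trans (by omega))
    by_cases hvx : v = x
    · subst hvx
      refine key y (fun w hw => ?_) hx
      simp only [SimpleGraph.mem_neighborSet, SimpleGraph.sup_adj, SimpleGraph.edge_adj] at hw
      simp only [Set.mem_insert_iff, SimpleGraph.mem_neighborSet]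
      grind
    · by_cases hvy : v = y
      · subst hvy
        refine key x (fun w hw => ?_) hy
        simp only [SimpleGraph.mem_neighborSet, SimpleGraph.sup_adj, SimpleGraph.edge_adj] at hw
        simp only [Set.mem_insert_iff, SimpleGraph.mem_neighborSet]
        grind
      · refine (Set.ncard_le_ncard (fun w hw => ?_)).trans (hTd v)
        simp only [SimpleGraph.mem_neighborSet, SimpleGraph.sup_adj, SimpleGraph.edge_adj] at hw
        simp only [SimpleGraph.mem_neighborSet]
        grind
  exact hxy (hle (by simp [SimpleGraph.edge_adj, hne])).reachable

/-- A graph is acyclic if its vertices have a rank such that each edge joins a vertex to its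
parent, which has smaller rank. -/
theorem isAcyclic_of_parent {V : Type} {G : SimpleGraph V} (rank : V → ℕ) (parent : V → V)
    (h : ∀ x y, G.Adj x y →
      (rank x < rank y ∧ x = parent y) ∨ (rank y < rank x ∧ y = parent x)) : G.IsAcyclic := by
  classical
  intro v c hc
  -- At a vertex of largest rank on the cycle, both cycle neighbors must be its parent.
  obtain ⟨x, hx, hmax⟩ := c.support.toFinset.exists_max_image rank ⟨v, by simp⟩
  rw [List.mem_toFinset] at hx
  have hc' := hc.rotate hx
  set p := c.rotate x hx
  have hmem : ∀ y ∈ p.support, rank y ≤ rank x := fun y hy =>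
    hmax y (by
      rw [List.mem_toFinset]
      exact (SimpleGraph.Walk.mem_support_rotate_iff ..).1 hy)
  have h1 := h _ _ (p.adj_snd hc'.not_nil)
  have h2 := h _ _ (p.adj_penultimate hc'.not_nil)
  have h3 := hmem _ (p.getVert_mem_support 1)
  have h4 := hmem _ (p.getVert_mem_support (p.length - 1))
  refine hc'.snd_ne_penultimate ?_
  simp only [SimpleGraph.Walk.snd, SimpleGraph.Walk.penultimate] at *
  grind

/-! ### Balls and locality -/

theorem mem_ballNodes_iff {V : Type} {G : SimpleGraph V} {u v : V} {r : ℕ} :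
    v ∈ ballNodes G u r ↔ ∃ p : G.Walk u v, p.length ≤ r := by
  constructor
  · intro h
    have h : G.edist u v ≤ (r : ℕ∞) := h
    obtain ⟨p, hp⟩ := SimpleGraph.exists_walk_of_edist_ne_top
      (ne_top_of_le_ne_top (ENat.natCast_ne_top r) h)
    exact ⟨p, by rw [← hp] at h; exact_mod_cast h⟩
  · rintro ⟨p, hp⟩
    exact (p.edist_le).trans (by exact_mod_cast hp)

theorem self_mem_ballNodes {V : Type} (G : SimpleGraph V) (u : V) (r : ℕ) :
    u ∈ ballNodes G u r :=
  mem_ballNodes_iff.2 ⟨.nil, Nat.zero_le _⟩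

theorem ballNodes_mono {V : Type} (G : SimpleGraph V) (u : V) {r r' : ℕ} (h : r ≤ r') :
    ballNodes G u r ⊆ ballNodes G u r' := fun _ hv =>
  let ⟨p, hp⟩ := mem_ballNodes_iff.1 hv
  mem_ballNodes_iff.2 ⟨p, hp.trans h⟩

theorem ballNodes_subset_of_adj {V : Type} {G : SimpleGraph V} {u v : V} (h : G.Adj u v) (r : ℕ) :
    ballNodes G v r ⊆ ballNodes G u (r + 1) := fun _ hv =>
  let ⟨p, hp⟩ := mem_ballNodes_iff.1 hv
  mem_ballNodes_iff.2 ⟨.cons h p, by simpa using hp⟩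

/-- The next layer of a ball, in terms of the neighbors of its center. -/
theorem mem_ballNodes_succ_iff {V : Type} {G : SimpleGraph V} {u v : V} {r : ℕ} :
    v ∈ ballNodes G u (r + 1) ↔ v = u ∨ ∃ w, G.Adj u w ∧ v ∈ ballNodes G w r := by
  constructor
  · intro h
    obtain ⟨p, hp⟩ := mem_ballNodes_iff.1 h
    cases p with
    | nil => exact .inl rfl
    | cons hadj q => exact .inr ⟨_, hadj, mem_ballNodes_iff.2 ⟨q, by simpa using hp⟩⟩
  · rintro (rfl | ⟨w, hw, hv⟩)
    · exact self_mem_ballNodes ..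
    · exact ballNodes_subset_of_adj hw r hv

theorem ballNodes_congr {V : Type} {G G' : SimpleGraph V} {u : V} {r : ℕ}
    (h : ∀ x ∈ ballNodes G u r, ∀ y, G.Adj x y ↔ G'.Adj x y) :
    ballNodes G u r = ballNodes G' u r := by
  induction r generalizing u with
  | zero =>
    ext v
    simp [ballNodes]
  | succ r ih =>
    ext v
    rw [mem_ballNodes_succ_iff, mem_ballNodes_succ_iff]
    refine or_congr_right (exists_congr fun w => ?_)
    rw [← h u (self_mem_ballNodes ..)]
    refine and_congr_right fun hw => ?_
    rw [ih fun x hx => h x (ballNodes_subset_of_adj hw r hx)]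

/-- The labeled ball depends only on the adjacencies of the vertices in the ball. -/
theorem labeledBall_congr {V : Type} {G G' : SimpleGraph V} (ident : V → ℕ) {u : V} {r : ℕ}
    (h : ∀ x ∈ ballNodes G u r, ∀ y, G.Adj x y ↔ G'.Adj x y) :
    labeledBall G ident u r = labeledBall G' ident u r := by
  have hb := ballNodes_congr h
  ext a
  · rfl
  · simp only [labeledBall, hb]
  · simp only [labeledBall, ← hb]
    refine exists_congr fun v => and_congr_right fun hv => exists_congr fun w =>
      and_congr_right fun _ => ?_
    rw [h v hv]

/-! ### Round elimination on edge-colored graphs -/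

section RoundElimination

variable {Γ ι : Type}

/-- The end of the walk that starts at `g` and follows the colors of `w`, from right to left. -/
def walkEnd (s : ι → Γ → Γ) (g : Γ) (w : List ι) : Γ := w.foldr s g

/-- The set of ends of walks of length at most `k` from `g`. -/
def walkBall (s : ι → Γ → Γ) (k : ℕ) (g : Γ) : Set Γ :=
  {x | ∃ w : List ι, w.length ≤ k ∧ walkEnd s g w = x}

/-- The edge-colored graph given by `s` looks like a tree up to distance `R`: walks of length at
most `R` without backtracking that start at the same vertex have different ends. -/
def LocallyInjective (s : ι → Γ → Γ) (R : ℕ) : Prop :=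
  ∀ (g : Γ) (w w' : List ι), w.IsChain (· ≠ ·) → w'.IsChain (· ≠ ·) → w.length ≤ R →
    w'.length ≤ R → walkEnd s g w = walkEnd s g w' → w = w'

/-- `H x c` says that the edge of color `c` at `x` is selected; the two endpoints agree. -/
def IsEdgeSet (s : ι → Γ → Γ) (H : Γ → ι → Prop) : Prop := ∀ x c, H (s c x) c ↔ H x c

/-- All vertices that are reached from `g` by at most `k` selected edges have `Δ` selected edges. -/
def RegularWithin (s : ι → Γ → Γ) (Δ : ℕ) (H : Γ → ι → Prop) : ℕ → Γ → Prop
  | 0, g => {c | H g c}.ncard = Δ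
  | k + 1, g => {c | H g c}.ncard = Δ ∧ ∀ i, H g i → RegularWithin s Δ H k (s i g)

/-- The rule `f` determines outgoing edges from the edge set within distance `k`, such that no
vertex with a regular neighborhood has all its edges incoming, neither in its own view nor in the
views of its neighbors. -/
structure IsSinklessRule (s : ι → Γ → Γ) (Δ k : ℕ) (f : (Γ → ι → Prop) → Γ → ι → Prop) : Prop where
  congr : ∀ H H' g, IsEdgeSet s H → IsEdgeSet s H' →
    (∀ x ∈ walkBall s k g, ∀ c, H x c ↔ H' x c) → ∀ i, f H g i ↔ f H' g i
  exists_out : ∀ H g, IsEdgeSet s H → RegularWithin s Δ H k g → ∃ i, H g i ∧ f H g i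
  exists_not_in : ∀ H g, IsEdgeSet s H → RegularWithin s Δ H (k + 1) g →
    ∃ i, H g i ∧ ¬ f H (s i g) i

variable {s : ι → Γ → Γ} {Δ R k : ℕ} {H H' : Γ → ι → Prop} {g : Γ}

@[simp] theorem walkEnd_nil : walkEnd s g [] = g := rfl

@[simp] theorem walkEnd_cons (c : ι) (w : List ι) :
    walkEnd s g (c :: w) = s c (walkEnd s g w) := rfl

theorem walkEnd_append_singleton (w : List ι) (i : ι) :
    walkEnd s g (w ++ [i]) = walkEnd s (s i g) w := by
  simp [walkEnd]

theorem self_mem_walkBall (s : ι → Γ → Γ) (k : ℕ) (g : Γ) : g ∈ walkBall s k g :=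
  ⟨[], Nat.zero_le _, rfl⟩

theorem walkBall_mono {k k' : ℕ} (h : k ≤ k') : walkBall s k g ⊆ walkBall s k' g :=
  fun _ ⟨w, hw, hx⟩ => ⟨w, hw.trans h, hx⟩

theorem walkBall_step_subset (i : ι) : walkBall s k (s i g) ⊆ walkBall s (k + 1) g :=
  fun _ ⟨w, hw, hx⟩ => ⟨w ++ [i], by simpa using hw, by rw [walkEnd_append_singleton, hx]⟩

theorem mem_walkBall_neighbor (hs : ∀ i, Function.Involutive (s i)) (i : ι) :
    g ∈ walkBall s (k + 1) (s i g) := ⟨[i], by simp, by simp [hs i g]⟩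

theorem isChain_cons_of_head?_ne {c : ι} {w : List ι} (hw : w.IsChain (· ≠ ·))
    (h : w.head? ≠ some c) : (c :: w).IsChain (· ≠ ·) := by
  rw [List.isChain_cons]
  exact ⟨fun y hy hcy => h (by rw [hcy]; exact hy), hw⟩

theorem exists_isChain_walkEnd_eq (hs : ∀ i, Function.Involutive (s i)) (g : Γ) (w : List ι) :
    ∃ w' : List ι, w'.IsChain (· ≠ ·) ∧ w'.length ≤ w.length ∧ walkEnd s g w' = walkEnd s g w := by
  induction w with
  | nil => exact ⟨[], .nil, le_rfl, rfl⟩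
  | cons c w ih =>
    obtain ⟨w', hw', hl, he⟩ := ih
    by_cases hc : w'.head? = some c
    · obtain ⟨w'', rfl⟩ := List.head?_eq_some_iff.1 hc
      refine ⟨w'', hw'.tail, by simp at hl ⊢; omega, ?_⟩
      rw [walkEnd_cons, ← he, walkEnd_cons, hs]
    · exact ⟨c :: w', isChain_cons_of_head?_ne hw' hc, by simpa using hl, by simp [he]⟩

/-- A vertex close to a neighbor of `g` is close to `g`, or reached through that neighbor. -/
theorem mem_walkBall_or_exists_append (hs : ∀ i, Function.Involutive (s i)) {i : ι} {x : Γ}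
    (hx : x ∈ walkBall s (k + 1) (s i g)) :
    x ∈ walkBall s k g ∨ ∃ w : List ι, (w ++ [i]).IsChain (· ≠ ·) ∧ w.length ≤ k + 1 ∧
      walkEnd s g (w ++ [i]) = x := by
  obtain ⟨w₀, hl₀, hx₀⟩ := hx
  obtain ⟨w, hw, hl, he⟩ := exists_isChain_walkEnd_eq hs (s i g) w₀
  rw [hx₀] at he
  rcases List.eq_nil_or_concat w with rfl | ⟨u, j, rfl⟩
  · exact .inr ⟨[], by simp, by simp, by simpa using he⟩
  · by_cases hij : j = i
    · subst hij
      left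
      rw [List.concat_eq_append] at he hl
      refine ⟨u, by simp at hl; omega, ?_⟩
      rw [← he, walkEnd_append_singleton, hs]
    · right
      refine ⟨u.concat j, ?_, by omega, by rw [walkEnd_append_singleton, he]⟩
      rw [List.isChain_append]
      refine ⟨hw, by simp, fun x hx y hy => ?_⟩
      simp at hx hy
      subst hx hy
      exact hij

/-- The parts of the graph behind two different neighbors of `g` have no edge in common. -/
theorem mem_walkBall_of_mem_of_mem (hs : ∀ i, Function.Involutive (s i))
    (hR : LocallyInjective s R) (hk : k + 3 ≤ R) {i j c : ι} (hij : i ≠ j) {x : Γ}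
    (hx : x ∈ walkBall s (k + 1) (s i g))
    (hy : x ∈ walkBall s (k + 1) (s j g) ∨ s c x ∈ walkBall s (k + 1) (s j g)) :
    x ∈ walkBall s k g ∨ s c x ∈ walkBall s k g := by
  by_contra! hcon
  obtain ⟨hx0, hy0⟩ := hcon
  obtain hx | ⟨w, hw, hl, hxw⟩ := mem_walkBall_or_exists_append hs hx
  · exact hx0 hx
  -- The last letter of a word is the first step from `g`, so reduced words ending in `i` and `j`
  -- differ; with at most `k + 3` letters, so do their ends.
  have key : ∀ w₁ w₂ : List ι, (w₁ ++ [i]).IsChain (· ≠ ·) → (w₂ ++ [j]).IsChain (· ≠ ·) →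
      w₁.length ≤ k + 2 → w₂.length ≤ k + 2 →
      walkEnd s g (w₁ ++ [i]) ≠ walkEnd s g (w₂ ++ [j]) := by
    intro w₁ w₂ h₁ h₂ hl₁ hl₂ he
    have := hR g _ _ h₁ h₂ (by simp; omega) (by simp; omega) he
    exact hij (by simpa using (List.append_inj' this rfl).2)
  rcases hy with hy | hy
  · obtain hy | ⟨u, hu, hlu, hyu⟩ := mem_walkBall_or_exists_append hs hy
    · exact hx0 hy
    · exact key w u hw hu (by omega) (by omega) (hxw.trans hyu.symm)
  · obtain hy | ⟨u, hu, hlu, hyu⟩ := mem_walkBall_or_exists_append hs hy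
    · exact hy0 hy
    -- The edge `c` at `x` either retraces the last step of the walk or prolongs it.
    by_cases hc : (w ++ [i]).head? = some c
    · cases w with
      | nil =>
        obtain rfl : i = c := by simpa using hc
        apply hy0
        rw [← hxw]
        exact ⟨[], by simp, by simp [hs i g]⟩
      | cons a w =>
        obtain rfl : a = c := by simpa using hc
        refine key w u hw.tail hu (by simp at hl; omega) (by omega) ?_
        rw [hyu, ← hxw, List.cons_append, walkEnd_cons, hs]
    · refine key (c :: w) u (isChain_cons_of_head?_ne hw hc) hu (by simpa using hl) (by omega) ?_
      rw [hyu, ← hxw, List.cons_append, walkEnd_cons]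

theorem step_ne_self (hR : LocallyInjective s R) (h : 1 ≤ R) (i : ι) (g : Γ) : s i g ≠ g := by
  intro he
  have := hR g [i] [] (by simp) (by simp) (by simpa) (by simp) (by simpa)
  simp at this

theorem step_injective (hR : LocallyInjective s R) (h : 1 ≤ R) {i j : ι} {g : Γ}
    (he : s i g = s j g) : i = j := by
  simpa using hR g [i] [j] (by simp) (by simp) (by simpa) (by simpa) (by simpa)

theorem RegularWithin.ncard (h : RegularWithin s Δ H k g) : {c | H g c}.ncard = Δ := by
  cases k with
  | zero => exact h
  | succ k => exact h.1

theorem RegularWithin.of_succ (h : RegularWithin s Δ H (k + 1) g) : RegularWithin s Δ H k g := by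
  induction k generalizing g with
  | zero => exact h.1
  | succ k ih => exact ⟨h.1, fun i hi => ih (h.2 i hi)⟩

theorem RegularWithin.congr (hHH : ∀ x ∈ walkBall s k g, ∀ c, H x c ↔ H' x c)
    (h : RegularWithin s Δ H k g) : RegularWithin s Δ H' k g := by
  have hset : {c | H g c} = {c | H' g c} := Set.ext fun c => hHH g (self_mem_walkBall ..) c
  induction k generalizing g with
  | zero => rw [RegularWithin, ← hset]; exact h
  | succ k ih =>
    refine ⟨hset ▸ h.1, fun i hi => ?_⟩
    have h' := fun x hx => hHH x (walkBall_step_subset i hx)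
    exact ih h' (h.2 i ((hHH g (self_mem_walkBall ..) i).2 hi))
      (Set.ext fun c => h' _ (self_mem_walkBall ..) c)

/-- Edge sets that agree where they overlap have a common extension. -/
theorem exists_isEdgeSet_of_compatible (hs : ∀ i, Function.Involutive (s i)) {α : Type}
    (U : α → Set Γ) (E : α → Γ → ι → Prop) (hE : ∀ a, IsEdgeSet s (E a))
    (hcomp : ∀ a b x c, x ∈ U a → (x ∈ U b ∨ s c x ∈ U b) → E b x c → E a x c) :
    ∃ H : Γ → ι → Prop, IsEdgeSet s H ∧ ∀ a, ∀ x ∈ U a, ∀ c, E a x c ↔ H x c := by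
  refine ⟨fun x c => ∃ a, (x ∈ U a ∨ s c x ∈ U a) ∧ E a x c, fun x c => ?_, fun a x hx c => ?_⟩
  · simp only [hs c x, hE _ x c]
    exact exists_congr fun a => and_congr_left fun _ => or_comm
  · exact ⟨fun h => ⟨a, .inl hx, h⟩, fun ⟨b, hb, h⟩ => hcomp a b x c hx hb h⟩

/-- Round elimination: an outgoing edge of `g` is one which no extension of the view of `g` makes
outgoing at the other endpoint. -/
theorem IsSinklessRule.eliminate (hs : ∀ i, Function.Involutive (s i))
    (hR : LocallyInjective s R) (hk : k + 3 ≤ R) (hΔ : 1 ≤ Δ)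
    {f : (Γ → ι → Prop) → Γ → ι → Prop} (hf : IsSinklessRule s Δ (k + 1) f) :
    ∃ f', IsSinklessRule s Δ k f' := by
  -- The regularity demanded of `H'` around `s i g` passes to the glued edge set below and makes it
  -- regular within `k + 2` of `g`.
  refine ⟨fun H g i => ¬ ∃ H', IsEdgeSet s H' ∧ (∀ x ∈ walkBall s k g, ∀ c, H x c ↔ H' x c) ∧
    RegularWithin s Δ H' (k + 1) (s i g) ∧ f H' (s i g) i, ?_, ?_, ?_⟩
  · intro H H' g _ _ hHH i
    refine not_congr (exists_congr fun E => and_congr_right fun _ => and_congr_left fun _ => ?_)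
    exact forall₂_congr fun x hx => forall_congr' fun c => by rw [hHH x hx c]
  · intro H g hH hreg
    by_contra! hcon
    have hcon' : ∀ a : {i // H g i}, ∃ H', IsEdgeSet s H' ∧
        (∀ x ∈ walkBall s k g, ∀ c, H x c ↔ H' x c) ∧
        RegularWithin s Δ H' (k + 1) (s a g) ∧ f H' (s a g) a := fun a => hcon a a.2
    choose E hE hHE hEreg hEf using hcon'
    obtain ⟨H', hH', hEH'⟩ := exists_isEdgeSet_of_compatible hs
      (fun a : {i // H g i} => walkBall s (k + 1) (s a g)) E hE (by
        intro a b x c hx hy hb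
        by_cases hab : a = b
        · exact hab ▸ hb
        obtain h | h := mem_walkBall_of_mem_of_mem hs hR hk (fun h => hab (Subtype.ext h)) hx hy
        · rwa [← hHE a x h, hHE b x h]
        · rwa [← hE a, ← hHE a _ h, hHE b _ h, hE b])
    obtain ⟨i₀, hi₀⟩ : ∃ i, H g i := by
      by_contra! hno
      have := hreg.ncard
      simp only [hno, Set.ofPred_false, Set.ncard_empty] at this
      omega
    -- The glued set is controlled only near neighbors of `g`; `g` itself is covered through `i₀`,
    -- which exists as `Δ` is positive.
    have hgH : ∀ c, H g c ↔ H' g c := fun c => by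
      rw [hHE ⟨i₀, hi₀⟩ g (self_mem_walkBall ..) c]
      exact hEH' ⟨i₀, hi₀⟩ g (mem_walkBall_neighbor hs i₀) c
    obtain ⟨i, hi, hfi⟩ := hf.exists_not_in H' g hH' ⟨by
      rw [← hreg.ncard]; exact congrArg Set.ncard (Set.ext fun c => (hgH c).symm), fun i hi =>
        (hEreg ⟨i, (hgH i).2 hi⟩).congr (hEH' ⟨i, (hgH i).2 hi⟩)⟩
    have hi' := (hgH i).2 hi
    exact hfi ((hf.congr _ _ _ (hE _) hH' (hEH' ⟨i, hi'⟩) i).1 (hEf ⟨i, hi'⟩))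
  · intro H g hH hreg
    obtain ⟨i, hi, hfi⟩ := hf.exists_out H g hH hreg
    -- `H` itself is an extension of the view of `s i g` that makes the edge outgoing at `g`.
    refine ⟨i, hi, fun h => h ⟨H, hH, fun _ _ _ => Iff.rfl, ?_⟩⟩
    rw [hs i g]
    exact ⟨hreg, hfi⟩

/-- There is no rule that only depends on the edges at each vertex. -/
theorem not_isSinklessRule_zero [Finite Γ] [Nonempty Γ] [Finite ι]
    (hs : ∀ i, Function.Involutive (s i)) (hR : LocallyInjective s R) (h2 : 2 ≤ R)
    (hΔ : 1 ≤ Δ) (hι : Nat.card ι = 2 * Δ - 1) (f : (Γ → ι → Prop) → Γ → ι → Prop) :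
    ¬ IsSinklessRule s Δ 0 f := by
  classical
  intro hf
  have := Fintype.ofFinite Γ
  have := Fintype.ofFinite ι
  rw [Nat.card_eq_fintype_card] at hι
  let O : Γ → Finset ι := fun g => {i | ∃ H, IsEdgeSet s H ∧ RegularWithin s Δ H 0 g ∧
    H g i ∧ f H g i}
  -- With fewer than `Δ` possible outputs, at least `Δ` of the `2 * Δ - 1` colors remain; selecting
  -- `Δ` of those leaves no edge to output.
  have hO : ∀ g, Δ ≤ (O g).card := by
    intro g
    by_contra! hlt
    have hcompl : Δ ≤ (O g)ᶜ.card := by rw [Finset.card_compl]; omega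
    obtain ⟨I, hI, hIc⟩ := Finset.exists_subset_card_eq hcompl
    let H : Γ → ι → Prop := fun x c => c ∈ I ∧ (x = g ∨ s c x = g)
    have hH : IsEdgeSet s H := fun x c => by simp only [H, hs c x, or_comm]
    have hreg : RegularWithin s Δ H 0 g := by
      have : {c | H g c} = (I : Set ι) := by ext; simp [H]
      rw [RegularWithin, this, Set.ncard_coe_finset, hIc]
    obtain ⟨i, hi, hfi⟩ := hf.exists_out H g hH hreg
    have := hI hi.1
    simp only [O, Finset.mem_compl, Finset.mem_filter, Finset.mem_univ, true_and] at this
    exact this ⟨H, hH, hreg, hi, hfi⟩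
  -- Double counting: each `s i` permutes the vertices, so claims received equal claims made.
  have hsum : ∑ g : Γ, (Finset.univ.filter fun i => i ∈ O (s i g)).card = ∑ g, (O g).card := by
    have h1 : ∀ g, (O g).card = ∑ i, if i ∈ O g then 1 else 0 := fun g => by simp
    simp only [h1, Finset.card_filter]
    rw [Finset.sum_comm, Finset.sum_comm (s := (Finset.univ : Finset Γ))]
    exact Finset.sum_congr rfl fun i _ =>
      Equiv.sum_comp ((hs i).toPerm (s i)) fun g => if i ∈ O g then 1 else 0
  obtain ⟨g, hg⟩ : ∃ g, Δ ≤ (Finset.univ.filter fun i => i ∈ O (s i g)).card := by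
    by_contra! hlt
    refine absurd hsum (ne_of_lt ?_)
    exact Finset.sum_lt_sum_of_nonempty Finset.univ_nonempty fun g _ => (hlt g).trans_le (hO g)
  obtain ⟨I, hI, hIc⟩ := Finset.exists_subset_card_eq hg
  have hI' : ∀ i : I, ∃ H, IsEdgeSet s H ∧ RegularWithin s Δ H 0 (s i g) ∧
      H (s i g) i ∧ f H (s i g) i := fun i => by
    have := hI i.2
    simpa [O] using this
  choose E hE hEreg hEi hEf using hI'
  -- `none` prescribes the edges `I` at `g`; `some i` prescribes, at the neighbor `s i g`, a
  -- selection making the edge to `g` outgoing there.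
  let U : Option I → Set Γ := fun a => a.elim {g} fun i => {s i g}
  let E' : Option I → Γ → ι → Prop := fun a => a.elim (fun x c => c ∈ I ∧ (x = g ∨ s c x = g)) E
  have hne := fun i g => step_ne_self hR (i := i) (g := g) (by omega)
  obtain ⟨H, hH, hEH⟩ := exists_isEdgeSet_of_compatible hs U E' (by
      rintro (_ | i)
      · exact fun x c => by simp only [E', Option.elim, hs c x, or_comm]
      · exact hE i) (by
      rintro (_ | i) (_ | j) x c hx hy hb
      · exact hb
      · obtain rfl : x = g := hx
        obtain hy | hy : x = s j x ∨ s c x = s j x := hy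
        · exact absurd hy.symm (hne _ _)
        · have := step_injective hR (by omega) hy
          exact ⟨this ▸ j.2, .inl rfl⟩
      · obtain rfl : x = s i g := hx
        obtain hy | hy : s i g = g ∨ s c (s i g) = g := hy
        · exact absurd hy (hne _ _)
        · have : c = i := step_injective hR (g := s i g) (by omega) (by rw [hy, hs])
          subst this
          exact hEi i
      · obtain rfl : x = s i g := hx
        obtain hy | hy : s i g = s j g ∨ s c (s i g) = s j g := hy
        · obtain rfl : i = j := Subtype.ext (step_injective hR (by omega) hy)
          exact hb
        -- This excludes triangles through `g`: two steps and one step would have the same end.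
        · by_cases hci : c = i
          · rw [hci, hs] at hy
            exact absurd hy.symm (hne _ _)
          · have := hR g [c, i] [j] (by simpa using hci) (by simp) (by simpa) (by simp; omega)
              (by simpa using hy)
            simp at this)
  have hgI : ∀ c, H g c ↔ c ∈ I := fun c => by
    rw [← hEH none g rfl c]
    simp [E']
  have hball : ∀ i : I, ∀ x ∈ walkBall s 0 (s i g), ∀ c, E i x c ↔ H x c := by
    rintro i x ⟨w, hw, rfl⟩ c
    obtain rfl : w = [] := List.eq_nil_of_length_eq_zero (Nat.le_zero.1 hw)
    exact hEH (some i) _ rfl c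
  obtain ⟨i, hi, hfi⟩ := hf.exists_not_in H g hH ⟨by
    rw [← hIc, ← Set.ncard_coe_finset]
    exact congrArg Set.ncard (Set.ext fun c => hgI c), fun i hi =>
      (hEreg ⟨i, (hgI i).1 hi⟩).congr (hball ⟨i, (hgI i).1 hi⟩)⟩
  exact hfi ((hf.congr _ _ _ (hE _) hH (hball ⟨i, (hgI i).1 hi⟩) i).1 (hEf _))

/-- Elimination lowers the radius to 0 in the same graph, without any loss in `R`. -/
theorem not_isSinklessRule [Finite Γ] [Nonempty Γ] [Finite ι]
    (hs : ∀ i, Function.Involutive (s i)) (hR : LocallyInjective s R) (hk : k + 2 ≤ R)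
    (hΔ : 1 ≤ Δ) (hι : Nat.card ι = 2 * Δ - 1) (f : (Γ → ι → Prop) → Γ → ι → Prop) :
    ¬ IsSinklessRule s Δ k f := by
  induction k generalizing f with
  | zero => exact not_isSinklessRule_zero hs hR hk hΔ hι f
  | succ k ih =>
    intro hf
    obtain ⟨f', hf'⟩ := hf.eliminate hs hR (by omega) hΔ
    exact ih (by omega) f' hf'

end RoundElimination

/-! ### From tree algorithms to rules on selected edge sets -/

section SelectedGraph

variable {Γ ι V : Type} {s : ι → Γ → Γ} {Δ R r : ℕ} {H H' : Γ → ι → Prop} {g : Γ} {e : Γ → V}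

/-- The graph of the selected edges, with the vertices renamed by `e`. -/
def selectedGraph (s : ι → Γ → Γ) (e : Γ → V) (H : Γ → ι → Prop) : SimpleGraph V :=
  SimpleGraph.fromRel fun x y => ∃ g c, H g c ∧ e g = x ∧ e (s c g) = y

theorem selectedGraph_adj (hs : ∀ i, Function.Involutive (s i)) (hR : LocallyInjective s R)
    (h1 : 1 ≤ R) (he : Function.Injective e) (hH : IsEdgeSet s H) {y : V} :
    (selectedGraph s e H).Adj (e g) y ↔ ∃ c, H g c ∧ e (s c g) = y := by
  rw [selectedGraph, SimpleGraph.fromRel_adj]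
  constructor
  · rintro ⟨-, ⟨a, c, hc, ha, hy⟩ | ⟨a, c, hc, ha, hy⟩⟩
    · obtain rfl := he ha
      exact ⟨c, hc, hy⟩
    · obtain rfl := he hy
      exact ⟨c, (hH a c).2 hc, by rw [hs, ha]⟩
  · rintro ⟨c, hc, rfl⟩
    exact ⟨fun h => step_ne_self hR h1 c g (he h).symm, .inl ⟨g, c, hc, rfl, rfl⟩⟩

theorem ncard_neighborSet_selectedGraph (hs : ∀ i, Function.Involutive (s i))
    (hR : LocallyInjective s R) (h1 : 1 ≤ R) (he : Function.Injective e) (hH : IsEdgeSet s H) :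
    ((selectedGraph s e H).neighborSet (e g)).ncard = {c | H g c}.ncard := by
  have : (selectedGraph s e H).neighborSet (e g) = (fun c => e (s c g)) '' {c | H g c} := by
    ext y
    exact selectedGraph_adj hs hR h1 he hH
  rw [this, Set.ncard_image_of_injective _ fun i j hij => step_injective hR h1 (he hij)]

/-- All edges along the walk are selected. -/
def IsSelectedWalk (s : ι → Γ → Γ) (H : Γ → ι → Prop) (g : Γ) : List ι → Prop
  | [] => True
  | c :: w => H (walkEnd s g w) c ∧ IsSelectedWalk s H g w

theorem RegularWithin.walkEnd (hreg : RegularWithin s Δ H r g) {w : List ι}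
    (hw : IsSelectedWalk s H g w) (hl : w.length ≤ r) :
    RegularWithin s Δ H (r - w.length) (walkEnd s g w) := by
  induction w with
  | nil => exact hreg
  | cons c w ih =>
    rw [List.length_cons] at hl
    have := ih hw.2 (by omega)
    rw [show r - w.length = r - (w.length + 1) + 1 by omega] at this
    exact this.2 c hw.1

/-- Cancelling backtracking only shortens a walk. Words grow at the head, hence the induction over
walks that end at `e g`. -/
theorem exists_isSelectedWalk_of_mem_ballNodes (hs : ∀ i, Function.Involutive (s i))
    (hR : LocallyInjective s R) (h1 : 1 ≤ R) (he : Function.Injective e) (hH : IsEdgeSet s H)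
    {x : V} (hx : x ∈ ballNodes (selectedGraph s e H) (e g) r) :
    ∃ w : List ι, w.IsChain (· ≠ ·) ∧ IsSelectedWalk s H g w ∧ w.length ≤ r ∧
      e (walkEnd s g w) = x := by
  suffices h : ∀ (v x : V) (p : (selectedGraph s e H).Walk x v), v = e g →
      ∃ w : List ι, w.IsChain (· ≠ ·) ∧ IsSelectedWalk s H g w ∧ w.length ≤ p.length ∧
        e (walkEnd s g w) = x by
    obtain ⟨p, hp⟩ := mem_ballNodes_iff.1 hx
    obtain ⟨w, hw, hsel, hl, he'⟩ := h _ _ p.reverse rfl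
    exact ⟨w, hw, hsel, by rw [SimpleGraph.Walk.length_reverse] at hl; omega, he'⟩
  intro v x p hv
  induction p with
  | nil => exact ⟨[], .nil, trivial, le_rfl, hv.symm⟩
  | cons hadj p ih =>
    obtain ⟨w, hw, hsel, hl, rfl⟩ := ih hv
    obtain ⟨c, hc, rfl⟩ := (selectedGraph_adj hs hR h1 he hH).1 hadj.symm
    by_cases hh : w.head? = some c
    · obtain ⟨w, rfl⟩ := List.head?_eq_some_iff.1 hh
      refine ⟨w, hw.tail, hsel.2, ?_, by rw [walkEnd_cons, hs]⟩
      rw [List.length_cons] at hl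
      exact (show w.length ≤ p.length + 1 by omega)
    · exact ⟨c :: w, isChain_cons_of_head?_ne hw hh, ⟨hc, hsel⟩, by simpa using hl, rfl⟩

/-- The edges of selected walks of length at most `r + 1` that start at `g`. -/
def walkForest (s : ι → Γ → Γ) (e : Γ → V) (H : Γ → ι → Prop) (g : Γ) (r : ℕ) : SimpleGraph V :=
  SimpleGraph.fromRel fun x y => ∃ c w, (c :: w).IsChain (· ≠ ·) ∧ IsSelectedWalk s H g (c :: w) ∧
    w.length ≤ r ∧ e (walkEnd s g w) = x ∧ e (walkEnd s g (c :: w)) = y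

theorem walkForest_le : walkForest s e H g r ≤ selectedGraph s e H := by
  have key : ∀ x y, (∃ c w, (c :: w).IsChain (· ≠ ·) ∧ IsSelectedWalk s H g (c :: w) ∧
      w.length ≤ r ∧ e (walkEnd s g w) = x ∧ e (walkEnd s g (c :: w)) = y) →
      ∃ g c, H g c ∧ e g = x ∧ e (s c g) = y := by
    rintro x y ⟨c, w, -, hw, -, hx, hy⟩
    exact ⟨_, c, hw.1, hx, hy⟩
  intro x y h
  rw [walkForest, SimpleGraph.fromRel_adj] at h
  rw [selectedGraph, SimpleGraph.fromRel_adj]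
  exact ⟨h.1, h.2.imp (key x y) (key y x)⟩

/-- Each vertex reached has a unique reduced word; its length serves as rank, and deleting its head
gives the parent. -/
theorem isAcyclic_walkForest (hR : LocallyInjective s R) (hr : r + 1 ≤ R)
    (he : Function.Injective e) : (walkForest s e H g r).IsAcyclic := by
  classical
  let word : V → List ι := fun x =>
    if h : ∃ w : List ι, w.IsChain (· ≠ ·) ∧ w.length ≤ R ∧ e (walkEnd s g w) = x then h.choose
    else []
  have hword : ∀ w : List ι, w.IsChain (· ≠ ·) → w.length ≤ R →
      word (e (walkEnd s g w)) = w := by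
    intro w hw hl
    have h : ∃ w' : List ι, w'.IsChain (· ≠ ·) ∧ w'.length ≤ R ∧
      e (walkEnd s g w') = e (walkEnd s g w) := ⟨w, hw, hl, rfl⟩
    simp only [word, dif_pos h]
    exact hR g _ _ h.choose_spec.1 hw h.choose_spec.2.1 hl (he h.choose_spec.2.2)
  have key : ∀ x y, (∃ c w, (c :: w).IsChain (· ≠ ·) ∧ IsSelectedWalk s H g (c :: w) ∧
      w.length ≤ r ∧ e (walkEnd s g w) = x ∧ e (walkEnd s g (c :: w)) = y) →
      (word x).length < (word y).length ∧ x = e (walkEnd s g (word y).tail) := by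
    rintro x y ⟨c, w, hc, -, hl, rfl, rfl⟩
    rw [hword _ hc (by simp; omega), hword w hc.tail (by omega)]
    simp
  refine isAcyclic_of_parent (fun x => (word x).length)
    (fun x => e (walkEnd s g (word x).tail)) fun x y hxy => ?_
  rw [walkForest, SimpleGraph.fromRel_adj] at hxy
  exact hxy.2.imp (key x y) (key y x)

theorem walkForest_adj_of_mem_ballNodes (hs : ∀ i, Function.Involutive (s i))
    (hR : LocallyInjective s R) (h1 : 1 ≤ R) (he : Function.Injective e) (hH : IsEdgeSet s H)
    {x y : V} (hx : x ∈ ballNodes (selectedGraph s e H) (e g) r)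
    (hxy : (selectedGraph s e H).Adj x y) : (walkForest s e H g r).Adj x y := by
  obtain ⟨w, hw, hsel, hl, rfl⟩ := exists_isSelectedWalk_of_mem_ballNodes hs hR h1 he hH hx
  rw [walkForest, SimpleGraph.fromRel_adj]
  refine ⟨hxy.ne, ?_⟩
  obtain ⟨c, hc, rfl⟩ := (selectedGraph_adj hs hR h1 he hH).1 hxy
  by_cases hh : w.head? = some c
  · obtain ⟨w, rfl⟩ := List.head?_eq_some_iff.1 hh
    exact .inr ⟨c, w, hw, hsel, by simp at hl; omega, by rw [walkEnd_cons, hs], rfl⟩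
  · exact .inl ⟨c, w, isChain_cons_of_head?_ne hw hh, ⟨hc, hsel⟩, hl, rfl, rfl⟩

/-- Up to depth `r` regularity bounds the degree; at depth `r + 1` only the parent is adjacent. -/
theorem ncard_neighborSet_walkForest_le [Finite V] (hs : ∀ i, Function.Involutive (s i))
    (hR : LocallyInjective s R) (hr : r + 1 ≤ R) (he : Function.Injective e)
    (hH : IsEdgeSet s H) (hΔ : 1 ≤ Δ) (hreg : RegularWithin s Δ H r g) (x : V) :
    ((walkForest s e H g r).neighborSet x).ncard ≤ Δ := by
  obtain hemp | ⟨y, hy⟩ := ((walkForest s e H g r).neighborSet x).eq_empty_or_nonempty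
  · simp [hemp]
  obtain ⟨w, hw, hsel, hl, rfl⟩ : ∃ w : List ι, w.IsChain (· ≠ ·) ∧ IsSelectedWalk s H g w ∧
      w.length ≤ r + 1 ∧ e (walkEnd s g w) = x := by
    rw [SimpleGraph.mem_neighborSet, walkForest, SimpleGraph.fromRel_adj] at hy
    obtain ⟨-, ⟨c, w, hw, hsel, hl, hx, -⟩ | ⟨c, w, hw, hsel, hl, -, hx⟩⟩ := hy
    · exact ⟨w, hw.tail, hsel.2, by omega, hx⟩
    · exact ⟨c :: w, hw, hsel, by simpa using hl, hx⟩
  by_cases hlr : w.length ≤ r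
  · refine (Set.ncard_le_ncard (t := (selectedGraph s e H).neighborSet _)
      fun y hy => walkForest_le hy).trans ?_
    rw [ncard_neighborSet_selectedGraph hs hR (by omega) he hH, (hreg.walkEnd hsel hlr).ncard]
  · have hsub : (walkForest s e H g r).neighborSet (e (walkEnd s g w)) ⊆
        {e (walkEnd s g w.tail)} := by
      intro z hz
      rw [SimpleGraph.mem_neighborSet, walkForest, SimpleGraph.fromRel_adj] at hz
      obtain ⟨-, ⟨c, w', hw', -, hl', hx, -⟩ | ⟨c, w', hw', -, hl', hx, hx'⟩⟩ := hz
      · have := hR g _ _ hw'.tail hw (by simp; omega) (by omega) (he hx)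
        simp at this
        subst this
        omega
      · have := hR g _ _ hw' hw (by simp; omega) (by omega) (he hx')
        subst this
        exact hx.symm
    exact (Set.ncard_le_ncard hsub).trans (by simpa using hΔ)

/-- A regular neighborhood in the selected graph looks like a neighborhood in some tree of
maximum degree at most `Δ`. -/
theorem exists_isTree_adj_iff [Finite V] (hs : ∀ i, Function.Involutive (s i))
    (hR : LocallyInjective s R) (hr : r + 1 ≤ R) (he : Function.Injective e)
    (hH : IsEdgeSet s H) (hΔ : 2 ≤ Δ) (hreg : RegularWithin s Δ H r g) :
    ∃ T : SimpleGraph V, T.IsTree ∧ (∀ v, (T.neighborSet v).ncard ≤ Δ) ∧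
      ∀ x ∈ ballNodes (selectedGraph s e H) (e g) r, ∀ y,
        (selectedGraph s e H).Adj x y ↔ T.Adj x y := by
  have : Nonempty V := ⟨e g⟩
  obtain ⟨T, hle, hT, hdeg⟩ := exists_isTree_ge_of_isAcyclic hΔ
    (isAcyclic_walkForest (H := H) (g := g) hR hr he)
    (ncard_neighborSet_walkForest_le hs hR hr he hH (by omega) hreg)
  refine ⟨T, hT, hdeg, fun x hx y => ?_⟩
  have hsub : (selectedGraph s e H).neighborSet x ⊆ T.neighborSet x := fun z hz =>
    hle (walkForest_adj_of_mem_ballNodes hs hR (by omega) he hH hx hz)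
  -- Vertices of the ball already have degree `Δ` in the forest, so the extension to `T` cannot add
  -- edges there.
  have hcard : (T.neighborSet x).ncard ≤ ((selectedGraph s e H).neighborSet x).ncard := by
    obtain ⟨w, -, hsel, hl, rfl⟩ :=
      exists_isSelectedWalk_of_mem_ballNodes hs hR (by omega) he hH hx
    rw [ncard_neighborSet_selectedGraph hs hR (by omega) he hH, (hreg.walkEnd hsel hl).ncard]
    exact hdeg _
  exact Set.ext_iff.1 (Set.eq_of_subset_of_ncard_le hsub hcard) y

theorem mem_walkBall_of_mem_ballNodes (hs : ∀ i, Function.Involutive (s i))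
    (hR : LocallyInjective s R) (h1 : 1 ≤ R) (he : Function.Injective e) (hH : IsEdgeSet s H)
    {x : V} (hx : x ∈ ballNodes (selectedGraph s e H) (e g) r) :
    ∃ a ∈ walkBall s r g, e a = x := by
  obtain ⟨w, -, -, hl, rfl⟩ := exists_isSelectedWalk_of_mem_ballNodes hs hR h1 he hH hx
  exact ⟨_, ⟨w, hl, rfl⟩, rfl⟩

/-- An algorithm for sinkless orientation on trees yields a rule for regular parts of a graph that
looks locally like a tree. -/
theorem SolvesSinklessOrientation.exists_isSinklessRule {A : LocalAlgorithm (Set ℕ)} {t : ℕ → ℕ}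
    {C n : ℕ} (hA : SolvesSinklessOrientation A t Δ C n) [Finite V] (hV : Nat.card V = n)
    {ident : V → ℕ} (hident : IsIdentifierAssignment (n ^ C) ident)
    (hs : ∀ i, Function.Involutive (s i)) (hR : LocallyInjective s R) (hr : t n + 2 ≤ R)
    (he : Function.Injective e) (hΔ : 2 ≤ Δ) : ∃ f, IsSinklessRule s Δ (t n + 1) f := by
  have hmain : ∀ H g, IsEdgeSet s H → RegularWithin s Δ H (t n + 1) g →
      ∃ T : SimpleGraph V, (∀ y, (selectedGraph s e H).Adj (e g) y ↔ T.Adj (e g) y) ∧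
        (∀ x ∈ ballNodes (selectedGraph s e H) (e g) (t n + 1), ∀ y,
          (selectedGraph s e H).Adj x y ↔ T.Adj x y) ∧
        IsOrientation T (outputDirections T ident (A.run t T ident)) ∧
        ∃ w, T.Adj (e g) w ∧ ¬ outputDirections T ident (A.run t T ident) w (e g) := by
    intro H g hH hreg
    obtain ⟨T, hT, hdeg, hadj⟩ := exists_isTree_adj_iff hs hR hr he hH hΔ hreg
    have hg := hadj (e g) (self_mem_ballNodes ..)
    obtain ⟨hor, hsink⟩ := hA V T ident hV hT hdeg hident
    refine ⟨T, hg, hadj, hor, ?_⟩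
    by_contra! hcon
    refine hsink (e g) ⟨?_, hcon⟩
    have : T.neighborSet (e g) = (selectedGraph s e H).neighborSet (e g) :=
      Set.ext fun y => (hg y).symm
    rw [this, ncard_neighborSet_selectedGraph hs hR (by omega) he hH, hreg.ncard]
  -- The algorithm runs on the selected graph, which need not be a tree. Radius `t n + 1` lets one
  -- tree `T` cover the views of `g` and of its neighbors.
  refine ⟨fun H g i => ident (e (s i g)) ∈
    A n (labeledBall (selectedGraph s e H) ident (e g) (t n)), ?_, ?_, ?_⟩
  · intro H H' g hH hH' hHH i
    have : labeledBall (selectedGraph s e H) ident (e g) (t n) =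
        labeledBall (selectedGraph s e H') ident (e g) (t n) := by
      refine labeledBall_congr ident fun x hx y => ?_
      obtain ⟨a, ha, rfl⟩ := mem_walkBall_of_mem_ballNodes hs hR (by omega) he hH hx
      rw [selectedGraph_adj hs hR (by omega) he hH, selectedGraph_adj hs hR (by omega) he hH']
      exact exists_congr fun c => and_congr_left fun _ =>
        hHH a (walkBall_mono (Nat.le_succ _) ha) c
    rw [this]
  · intro H g hH hreg
    obtain ⟨T, hg, hadj, hor, w, hw, hnot⟩ := hmain H g hH hreg
    obtain ⟨i, hi, rfl⟩ := (selectedGraph_adj hs hR (by omega) he hH).1 ((hg w).2 hw)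
    refine ⟨i, hi, ?_⟩
    have hout : outputDirections T ident (A.run t T ident) (e g) (e (s i g)) := by
      have := hor.2 _ _ hw
      simpa [Xor, hnot] using this
    have hmem := hout.2
    rw [LocalAlgorithm.run, hV] at hmem
    rwa [labeledBall_congr ident fun x hx =>
      hadj x (ballNodes_mono _ _ (Nat.le_succ _) hx)]
  · intro H g hH hreg
    obtain ⟨T, hg, hadj, hor, w, hw, hnot⟩ := hmain H g hH hreg.of_succ
    have hsw := (hg w).2 hw
    obtain ⟨i, hi, rfl⟩ := (selectedGraph_adj hs hR (by omega) he hH).1 hsw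
    refine ⟨i, hi, fun hin => hnot ⟨hw.symm, ?_⟩⟩
    rw [LocalAlgorithm.run, hV]
    rw [hs i g] at hin
    rwa [← labeledBall_congr ident fun x hx => hadj x (ballNodes_subset_of_adj hsw _ hx)]

end SelectedGraph

/-! ### A locally tree-like Cayley graph of logarithmic radius -/

section Reflections

variable {ι : Type} [Fintype ι] [DecidableEq ι]

/-- The reflection that replaces `x c` by `2 * ∑ j ≠ c, x j - x c`. These maps generate a free
product of groups of order two. -/
def coxeterReflection {K : Type} [CommRing K] (c : ι) (x : ι → K) : ι → K :=
  Function.update x c (2 * ∑ j, x j - 3 * x c)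

theorem sum_coxeterReflection {K : Type} [CommRing K] (c : ι) (x : ι → K) :
    ∑ j, coxeterReflection c x j = 3 * ∑ j, x j - 4 * x c := by
  have h := Finset.sum_update_of_mem (Finset.mem_univ c) x (2 * ∑ j, x j - 3 * x c)
  have h' := Finset.add_sum_erase Finset.univ x (Finset.mem_univ c)
  rw [← Finset.erase_eq] at h
  rw [coxeterReflection, h, ← h']
  ring

theorem coxeterReflection_involutive {K : Type} [CommRing K] (c : ι) :
    Function.Involutive (coxeterReflection (K := K) c) := by
  intro x
  rw [coxeterReflection, sum_coxeterReflection]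
  simp only [coxeterReflection, Function.update_self, Function.update_idem]
  rw [Function.update_eq_self_iff]
  ring

/-- The reflections as linear automorphisms. -/
def coxeterReflectionEquiv (K : Type) [CommRing K] (c : ι) : (ι → K) ≃ₗ[K] (ι → K) :=
  LinearEquiv.ofInvolutive
    { toFun := coxeterReflection c
      map_add' := fun x y => by
        ext j
        by_cases h : j = c
        · subst h
          simp [coxeterReflection, Finset.sum_add_distrib]
          ring
        · simp [coxeterReflection, h]
      map_smul' := fun a x => by
        ext j
        by_cases h : j = c
        · subst h
          simp [coxeterReflection, ← Finset.mul_sum]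
          ring
        · simp [coxeterReflection, h] }
    (coxeterReflection_involutive c)

theorem walkEnd_coxeterReflection_intCast {K : Type} [CommRing K] (x : ι → ℤ) (w : List ι) (j : ι) :
    ((walkEnd coxeterReflection x w j : ℤ) : K) =
      walkEnd coxeterReflection (fun i => (x i : K)) w j := by
  induction w generalizing j with
  | nil => rfl
  | cons c w ih =>
    simp only [walkEnd_cons]
    by_cases h : j = c
    · subst h
      simp [coxeterReflection, ih]
    · simp [coxeterReflection, h, ih]

/-- Ping-pong: the coordinate reflected last is the strict maximum, and reflecting another one makes
that the new maximum. -/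
theorem walkEnd_coxeterReflection_bounds (h3 : 3 ≤ Fintype.card ι) {w : List ι}
    (hw : w.IsChain (· ≠ ·)) :
    (∀ j, 1 ≤ walkEnd coxeterReflection (1 : ι → ℤ) w j ∧
      walkEnd coxeterReflection (1 : ι → ℤ) w j ≤ (2 * Fintype.card ι : ℤ) ^ w.length) ∧
    ∀ c, w.head? = some c → ∀ j, j ≠ c → walkEnd coxeterReflection (1 : ι → ℤ) w j <
      walkEnd coxeterReflection (1 : ι → ℤ) w c := by
  induction w with
  | nil => simp
  | cons c w ih =>
    obtain ⟨hb, hm⟩ := ih hw.tail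
    rw [List.isChain_cons] at hw
    rw [walkEnd_cons]
    set x := walkEnd coxeterReflection (1 : ι → ℤ) w
    have hsum2 : ∀ j, j ≠ c → x j + x c ≤ ∑ i, x i := fun j hj => by
      rw [← Finset.sum_pair hj]
      exact Finset.sum_le_sum_of_subset_of_nonneg (Finset.subset_univ _)
        fun i _ _ => by linarith [(hb i).1]
    have hsum3 : ∀ j k, j ≠ c → k ≠ c → j ≠ k → x j + x k + x c ≤ ∑ i, x i := fun j k hj hk hjk => by
      have : x j + x k + x c = ∑ i ∈ {j, k, c}, x i := by
        rw [Finset.sum_insert (by simp [hjk, hj]), Finset.sum_pair hk]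
        ring
      rw [this]
      exact Finset.sum_le_sum_of_subset_of_nonneg (Finset.subset_univ _)
        fun i _ _ => by linarith [(hb i).1]
    have hlt : ∀ j, j ≠ c → x j < 2 * ∑ i, x i - 3 * x c := by
      intro j hj
      cases w with
      | nil =>
        have hx : ∀ i, x i = 1 := fun i => rfl
        have : ∑ i, x i = Fintype.card ι := by simp [hx]
        rw [this, hx, hx]
        -- The first reflection turns a coordinate 1 into `2 * Fintype.card ι - 3`, which exceeds 1
        -- only from three coordinates on.
        have : (3 : ℤ) ≤ Fintype.card ι := by exact_mod_cast h3
        linarith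
      | cons k w =>
        have hck : k ≠ c := fun h => hw.1 k rfl h.symm
        have hk := hm k rfl
        by_cases hjk : j = k
        · subst hjk
          linarith [hsum2 j hj, hk c hj.symm]
        · linarith [hsum3 j k hj hck hjk, hk c hck.symm, (hb j).1, (hb c).1]
    have hpos : 1 ≤ 2 * ∑ i, x i - 3 * x c := by
      have : Nontrivial ι := Fintype.one_lt_card_iff_nontrivial.1 (by omega)
      obtain ⟨j, hj⟩ := exists_ne c
      linarith [hlt j hj, (hb j).1]
    have hup : ∑ i, x i ≤ Fintype.card ι * (2 * Fintype.card ι : ℤ) ^ w.length := by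
      have := Finset.sum_le_card_nsmul Finset.univ x _ fun i _ => (hb i).2
      simpa using this
    have hone : (1 : ℤ) ≤ 2 * Fintype.card ι := by
      have : (3 : ℤ) ≤ Fintype.card ι := by exact_mod_cast h3
      linarith
    constructor
    · intro j
      rw [List.length_cons, pow_succ]
      by_cases h : j = c
      · subst h
        rw [coxeterReflection, Function.update_self]
        exact ⟨hpos, by linarith [(hb j).1]⟩
      · rw [coxeterReflection, Function.update_of_ne h]
        exact ⟨(hb j).1, (hb j).2.trans (le_mul_of_one_le_right (by positivity) hone)⟩
    · intro c' hc' j hj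
      obtain rfl : c = c' := by simpa using hc'
      rw [coxeterReflection, Function.update_self, Function.update_of_ne hj]
      exact hlt j hj

/-- The largest coordinate reveals the head of the word; undo that reflection and repeat. -/
theorem eq_of_walkEnd_coxeterReflection_eq (h3 : 3 ≤ Fintype.card ι) {w w' : List ι}
    (hw : w.IsChain (· ≠ ·)) (hw' : w'.IsChain (· ≠ ·))
    (h : walkEnd coxeterReflection (1 : ι → ℤ) w = walkEnd coxeterReflection 1 w') : w = w' := by
  have : Nontrivial ι := Fintype.one_lt_card_iff_nontrivial.1 (by omega)
  have hne : ∀ (c : ι) (w : List ι), (c :: w).IsChain (· ≠ ·) →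
      walkEnd coxeterReflection (1 : ι → ℤ) (c :: w) ≠ 1 := by
    intro c w hw he
    obtain ⟨j, hj⟩ := exists_ne c
    have := (walkEnd_coxeterReflection_bounds h3 hw).2 c rfl j hj
    simp [he] at this
  induction w generalizing w' with
  | nil =>
    cases w' with
    | nil => rfl
    | cons c w' => exact absurd h.symm (hne c w' hw')
  | cons c w ih =>
    cases w' with
    | nil => exact absurd h (hne c w hw)
    | cons c' w' =>
      obtain rfl : c = c' := by
        by_contra hcc
        have h1 := (walkEnd_coxeterReflection_bounds h3 hw).2 c rfl c' (Ne.symm hcc)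
        have h2 := (walkEnd_coxeterReflection_bounds h3 hw').2 c' rfl c hcc
        rw [h] at h1
        exact lt_asymm h1 h2
      exact congrArg _ (ih hw.tail hw'.tail ((coxeterReflection_involutive c).injective h))

/-- The Cayley graph generated by the reflections modulo `m` looks locally like a tree. -/
theorem locallyInjective_coxeterReflectionEquiv (h3 : 3 ≤ Fintype.card ι) {R m : ℕ}
    (hm : (2 * Fintype.card ι) ^ R < m) :
    LocallyInjective (fun (c : ι) (g : (ι → ZMod m) ≃ₗ[ZMod m] (ι → ZMod m)) =>
      coxeterReflectionEquiv (ZMod m) c * g) R := by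
  intro g w w' hw hw' hl hl' he
  -- Applying the group elements to `g.symm 1` removes `g`.
  have happ : ∀ w : List ι, walkEnd (fun c g => coxeterReflectionEquiv (ZMod m) c * g) g w
      (g.symm 1) = walkEnd coxeterReflection 1 w := by
    intro w
    induction w with
    | nil => simp
    | cons c w ih =>
      rw [walkEnd_cons, walkEnd_cons, ← ih]
      rfl
  -- All coordinates lie in `[0, m)`, so congruence modulo `m` is equality.
  have hbound : ∀ w : List ι, w.IsChain (· ≠ ·) → w.length ≤ R → ∀ j,
      0 ≤ walkEnd coxeterReflection (1 : ι → ℤ) w j ∧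
        walkEnd coxeterReflection (1 : ι → ℤ) w j < m := by
    intro w hw hl j
    obtain ⟨h1, h2⟩ := (walkEnd_coxeterReflection_bounds h3 hw).1 j
    refine ⟨by linarith, h2.trans_lt ?_⟩
    have : (2 * Fintype.card ι) ^ w.length < m :=
      (Nat.pow_le_pow_right (by omega) hl).trans_lt hm
    exact_mod_cast this
  refine eq_of_walkEnd_coxeterReflection_eq h3 hw hw' (funext fun j => ?_)
  have hcast := congrFun ((happ w).symm.trans ((congrArg (fun h => h (g.symm 1)) he).trans
    (happ w'))) j
  have hone : (1 : ι → ZMod m) = fun i => (((1 : ι → ℤ) i : ℤ) : ZMod m) := by ext; simp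
  rw [hone, ← walkEnd_coxeterReflection_intCast, ← walkEnd_coxeterReflection_intCast,
    ZMod.intCast_eq_intCast_iff'] at hcast
  rwa [Int.emod_eq_of_lt (hbound w hw hl j).1 (hbound w hw hl j).2,
    Int.emod_eq_of_lt (hbound w' hw' hl' j).1 (hbound w' hw' hl' j).2] at hcast

theorem finite_linearEquiv_zmod_pi (ι : Type) [Fintype ι] [DecidableEq ι] (m : ℕ) [NeZero m] :
    Finite ((ι → ZMod m) ≃ₗ[ZMod m] (ι → ZMod m)) :=
  Finite.of_injective (fun g => LinearMap.toMatrix' g.toLinearMap)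
    (LinearMap.toMatrix'.injective.comp LinearEquiv.toLinearMap_injective)

theorem card_linearEquiv_zmod_pi_le (ι : Type) [Fintype ι] [DecidableEq ι] (m : ℕ) [NeZero m] :
    Nat.card ((ι → ZMod m) ≃ₗ[ZMod m] (ι → ZMod m)) ≤ m ^ (Fintype.card ι * Fintype.card ι) := by
  have := Nat.card_le_card_of_injective
    (fun g : (ι → ZMod m) ≃ₗ[ZMod m] (ι → ZMod m) => LinearMap.toMatrix' g.toLinearMap)
    (LinearMap.toMatrix'.injective.comp LinearEquiv.toLinearMap_injective)
  refine this.trans (le_of_eq ?_)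
  simp [Matrix, pow_mul]

end Reflections

/-- For every `n` there is a locally tree-like `d`-regular graph on at most `n` vertices, where
`d ≥ 3`, up to a distance that is logarithmic in `n`. -/
theorem exists_locallyInjective {d : ℕ} (hd : 3 ≤ d) {R n : ℕ} (hR : 1 ≤ R)
    (hn : ((4 * d) ^ (d * d)) ^ R ≤ n) :
    ∃ (Γ : Type) (s : Fin d → Γ → Γ), Finite Γ ∧ Nonempty Γ ∧ Nat.card Γ ≤ n ∧
      (∀ i, Function.Involutive (s i)) ∧ LocallyInjective s R := by
  have := finite_linearEquiv_zmod_pi (Fin d) ((2 * d) ^ R + 1)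
  refine ⟨(Fin d → ZMod ((2 * d) ^ R + 1)) ≃ₗ[ZMod ((2 * d) ^ R + 1)] (Fin d → _),
    fun c g => coxeterReflectionEquiv _ c * g, this, ⟨1⟩, ?_, fun i g => ?_,
    locallyInjective_coxeterReflectionEquiv (by simpa) (by simp)⟩
  · refine (card_linearEquiv_zmod_pi_le _ _).trans (le_trans ?_ hn)
    -- What remains is `(2 * d) ^ R + 1 ≤ (4 * d) ^ R`.
    rw [Fintype.card_fin, ← pow_mul, mul_comm (d * d) R, pow_mul (4 * d)]
    refine Nat.pow_le_pow_left ?_ _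
    have h1 : 2 * d ≤ (2 * d) ^ R := Nat.le_self_pow (by omega) _
    have h2 : 2 ≤ 2 ^ R := Nat.le_self_pow (by omega) _
    have h3 : (4 * d) ^ R = 2 ^ R * (2 * d) ^ R := by rw [← mul_pow]; ring
    rw [h3]
    nlinarith
  · ext x
    simp only [LinearEquiv.mul_apply]
    exact congrFun (coxeterReflection_involutive i (g x)) _

/-! ### The logarithmic bound -/

theorem mainTheorem8 (Δ : ℕ) (hΔ : 2 ≤ Δ) :
    ∃ c : ℝ, 0 < c ∧ ∃ n₀ : ℕ, ∀ C : ℕ, 1 ≤ C →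
      ∀ (t : ℕ → ℕ) (A : LocalAlgorithm (Set ℕ)), ∀ n : ℕ, n₀ ≤ n →
        SolvesSinklessOrientation A t Δ C n → c * Real.log (n : ℝ) ≤ (t n : ℝ) := by
  obtain ⟨d, hd⟩ : ∃ d, d = 2 * Δ - 1 := ⟨_, rfl⟩
  obtain ⟨b, hb⟩ : ∃ b, b = (4 * d) ^ (d * d) := ⟨_, rfl⟩
  have hb1 : 1 < b := hb ▸ Nat.one_lt_pow (by nlinarith [show 3 ≤ d by omega]) (by omega)
  have hlogb : 0 < Real.log b := Real.log_pos (by exact_mod_cast hb1)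
  -- The contradiction gives `n < b ^ (t n + 3)`; from `b ^ 6` on, the loss of `3 * Real.log b` is
  -- at most half of `Real.log n`.
  refine ⟨1 / (2 * Real.log b), by positivity, b ^ 6, fun C hC t A n hn hA => ?_⟩
  have hn0 : n ≠ 0 := fun h => by
    have := Nat.pow_pos (n := 6) (by omega : 0 < b)
    omega
  have hlt : n < b ^ (t n + 3) := by
    by_contra! hle
    obtain ⟨Γ, s, _, _, hcard, hs, hR⟩ :=
      -- The rule has radius `t n + 1`, and refuting radius `k` needs `k + 2 ≤ R`.
      exists_locallyInjective (R := t n + 3) (n := n) (by omega : 3 ≤ d) (by omega) (hb ▸ hle)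
    have hcard' : Nat.card Γ ≤ Nat.card (Fin n) := by simpa using hcard
    obtain ⟨e⟩ : Nonempty (Γ ↪ Fin n) := by
      have := Fintype.ofFinite Γ
      exact Function.Embedding.nonempty_of_card_le (by
        rwa [Nat.card_eq_fintype_card, Nat.card_eq_fintype_card] at hcard')
    have hident : IsIdentifierAssignment (n ^ C) fun v : Fin n => (v : ℕ) + 1 :=
      ⟨fun v w h => Fin.ext (by simpa using h), fun v => ⟨Nat.succ_pos _,
        (show (v : ℕ) + 1 ≤ n from v.2).trans (Nat.le_self_pow (by omega) n)⟩⟩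
    obtain ⟨f, hf⟩ := hA.exists_isSinklessRule (by simp) hident hs hR (by omega) e.injective hΔ
    exact not_isSinklessRule hs hR (by omega) (by omega) (by simp [hd]) f hf
  have hpos : (0 : ℝ) < n := by exact_mod_cast Nat.pos_of_ne_zero hn0
  have h1 : Real.log n < (t n + 3) * Real.log b := by
    have : (n : ℝ) < (b : ℝ) ^ (t n + 3) := by exact_mod_cast hlt
    have := Real.log_lt_log hpos this
    rw [Real.log_pow] at this
    exact_mod_cast this
  have h2 : 6 * Real.log b ≤ Real.log n := by
    have : (b : ℝ) ^ 6 ≤ n := by exact_mod_cast hn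
    have := Real.log_le_log (by positivity) this
    rw [Real.log_pow] at this
    exact_mod_cast this
  rw [one_div, inv_mul_le_iff₀ (by positivity)]
  linarith
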